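/- Let $(\Omega,\mathcal F)$ be a measurable space carrying real random variables $X_1,X_2,\dots$, let $S_k=\sum_{i=1}^k X_i$, let $\mathcal F_n=\sigma(X_1,\dots,X_n)$ for $n\ge 0$ (with $\mathcal F_0$ trivial), and let $\overline{\mathcal P}$ be the set of all probability measures on $(\Omega,\mathcal F)$ under which $(X_n)_{n\ge1}$ is a sequence of i.i.d. integrable random variables with expected value zero. Let $q\in[1,2)$ and $\mathcal P\subset\overline{\mathcal P}$. A $\mathcal P$-$e$-process is an $(\mathcal F_n)_{n\ge 0}$-adapted process $(E_n)_{n\ge0}$ with values in $[0,\infty)$ such that $\mathsf E_P[E_\tau]\le 1$ for every $P\in\mathcal P$ and every $(\mathcal F_n)$-stopping time $\tau$ with values in $\{0,1,2,\dots\}\cup\{\infty\}$, where $E_\infty:=\limsup_{n\to\infty}E_n$. For $m\in\mathbb N$ and $\varepsilon>0$ let $$A^{(m,\varepsilon)}:=\bigcup_{k\ge m}\left\{\frac{|S_k|}{k^{1/q}}\ge\varepsilon\right\}.$$ Then the following three conditions are equivalent: (i) $X_1$ has a uniformly integrable $q$-th moment over $\mathcal P$: $$\lim_{x\to\infty}\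 \sup_{P\in\mathcal P}\mathsf E_P\left[|X_1|^q\mathbf 1\{|X_1|^q\ge x\}\right]=0.$$ (ii) The strong law of large numbers holds uniformly in $\mathcal P$ at the rate $o(n^{1/q-1})$: for every $\varepsilon>0$, $$\lim_{m\to\infty}\ \sup_{P\in\mathcal P}P\left[\sup_{k\ge m}\frac{|S_k|}{k^{1/q}}\ge\varepsilon\right]=0.$$ (iii) There is a $\mathcal P$-$e$-process $(E_n)_{n\ge0}$ that diverges pathwise to $\infty$ tail-uniformly on the event lattice $(A^{(m,\varepsilon)})_{m\in\mathbb N,\varepsilon>0}$, that is, for every $\varepsilon>0$, $$\lim_{m\to\infty}\ \inf_{\omega\in A^{(m,\varepsilon)}}\ \sup_{n\ge1}E_n(\omega)=\infty.$$ Suprema over $\mathcal P$ are taken in $[0,\infty]$ (so the supremum over the empty family is $0$), and the infimum over the empty set is $\infty$. -/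

import Mathlib

open MeasureTheory ProbabilityTheory Filter Topology
open scoped ENNReal

noncomputable section

namespace UniformSLLN

variable {Ω : Type*} [mΩ : MeasurableSpace Ω]

/-- The process is indexed from zero: `X i` is the random variable usually written `X_{i+1}`, so
that `X 0` is the first observation. `PartialSum X k` is the sum of the first `k` observations. -/
def PartialSum (X : ℕ → Ω → ℝ) (k : ℕ) (ω : Ω) : ℝ := ∑ i ∈ Finset.range k, X i ω

/-- The normalised partial sum `|S_k| / k^{1/q}`. -/
def NormSum (X : ℕ → Ω → ℝ) (q : ℝ) (k : ℕ) (ω : Ω) : ℝ :=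
  |PartialSum X k ω| / (k : ℝ) ^ (1 / q)

/-- All probability measures under which `X` is a sequence of i.i.d. integrable random variables
with expected value zero. -/
def MeanZeroIID (X : ℕ → Ω → ℝ) : Set (Measure Ω) :=
  {P | IsProbabilityMeasure P ∧ iIndepFun X P ∧ (∀ i, IdentDistrib (X i) (X 0) P P) ∧
    Integrable (X 0) P ∧ ∫ ω, X 0 ω ∂P = 0}

/-- The filtration generated by the process: at time `n` it is generated by the first `n`
observations; at time `0` it is trivial. -/
def GeneratedFiltration (X : ℕ → Ω → ℝ) (hX : ∀ i, Measurable (X i)) : Filtration ℕ mΩ where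
  seq n := ⨆ i, ⨆ _ : i < n, MeasurableSpace.comap (X i) inferInstance
  mono' _ _ hmn := iSup_mono fun _ => iSup_le fun hi => le_iSup_of_le (lt_of_lt_of_le hi hmn) le_rfl
  le' _ := iSup_le fun i => iSup_le fun _ => (hX i).comap_le

/-- The value `E_τ` at a possibly infinite random time, with `E_∞ = limsup_n E_n`. -/
def ValueAt (E : ℕ → Ω → ℝ) (τ : Ω → WithTop ℕ) (ω : Ω) : ℝ≥0∞ :=
  match τ ω with
  | (n : ℕ) => ENNReal.ofReal (E n ω)
  | ⊤ => limsup (fun n => ENNReal.ofReal (E n ω)) atTop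

/-- `E` is a `Ps`-e-process for the filtration `ℱ`: nonnegative, adapted, and with expectation at
most one at every stopping time (finite or not) under every member of `Ps`. -/
structure IsEProcess (ℱ : Filtration ℕ mΩ) (Ps : Set (Measure Ω)) (E : ℕ → Ω → ℝ) : Prop where
  adapted : Adapted ℱ E
  nonneg : ∀ n ω, 0 ≤ E n ω
  lintegral_le_one : ∀ P ∈ Ps, ∀ τ : Ω → WithTop ℕ, IsStoppingTime ℱ τ →
    ∫⁻ ω, ValueAt E τ ω ∂P ≤ 1

/-- `E` diverges pathwise to infinity tail-uniformly on the collection of events `A m ε`: for every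
`ε > 0`, `inf_{ω ∈ A m ε} sup_{n ≥ 1} E_n(ω)` tends to infinity with `m` (in `[0, ∞]`, so that the
infimum over the empty set is infinite). -/
def DivergesTailUniformly (E : ℕ → Ω → ℝ) (A : ℕ → ℝ → Set Ω) : Prop :=
  ∀ ε : ℝ, 0 < ε →
    Tendsto (fun m : ℕ => ⨅ ω ∈ A m ε, ⨆ n : ℕ, ⨆ _ : 1 ≤ n, ENNReal.ofReal (E n ω)) atTop (𝓝 ⊤)

/-- The event lattice `⋃_{k ≥ m} {|S_k| / k^{1/q} ≥ ε}`. -/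
def DivLattice (X : ℕ → Ω → ℝ) (q : ℝ) (m : ℕ) (ε : ℝ) : Set Ω :=
  ⋃ k : ℕ, ⋃ _ : m ≤ k, {ω | ε ≤ NormSum X q k ω}

/-- The `q`-th absolute moment of the first observation is uniformly integrable over `Ps`. -/
def UnifIntegrableMoment (X : ℕ → Ω → ℝ) (q : ℝ) (Ps : Set (Measure Ω)) : Prop :=
  Tendsto (fun x : ℝ => ⨆ P ∈ Ps,
    ∫⁻ ω in {ω | x ≤ |X 0 ω| ^ q}, ENNReal.ofReal (|X 0 ω| ^ q) ∂P) atTop (𝓝 0)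

/-- The strong law holds uniformly over `Ps` at the rate `o(n^{1/q - 1})`. The supremum over
`k ≥ m` is taken in `[0, ∞]`. -/
def UniformStrongLaw (X : ℕ → Ω → ℝ) (q : ℝ) (Ps : Set (Measure Ω)) : Prop :=
  ∀ ε : ℝ, 0 < ε →
    Tendsto (fun m : ℕ => ⨆ P ∈ Ps,
      P {ω | ENNReal.ofReal ε ≤ ⨆ k : ℕ, ⨆ _ : m ≤ k, ENNReal.ofReal (NormSum X q k ω)})
      atTop (𝓝 0)

end UniformSLLN

end

/-! The uniform strong law is the hub: each of the other two conditions is shown equivalent to it.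

Moment to strong law: the Marcinkiewicz–Zygmund argument with explicit constants. Time is cut into
dyadic blocks. In block `j` the variables are truncated at `|x| ^ q < 2 ^ j`; a large partial sum
then needs either a truncated summand or a large centred truncated sum, which Kolmogorov's
inequality controls (`measure_exists_le_abs_partialSum_le`). Adding the bounds over all blocks
before integrating leaves a constant times the tail of `|X 0| ^ q` above a level `b`, plus a
multiple of `|X 0| ^ q` that vanishes as the first block moves to infinity with `b` fixed
(`sum_blockBound_le`). Convergence of the geometric series is where `q < 2` enters. The measure is
felt only through its tail moment, so the bound is uniform.

Strong law to moment: a jump `|X k| ^ q ≥ k + 1` forces a large normalised sum at time `k` or `k +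
1`. Independence turns the small probability of seeing any such jump into a small sum of jump
probabilities (`sum_measure_le_of_iIndepFun`), and that sum dominates the tail moment
(`setLIntegral_le_tsum`).

Strong law to e-process: count how many of a sequence of rare lattice events, with uniform
probabilities at most `2⁻¹ ^ (j + 1)`, have occurred so far. The converse is Ville's inequality. -/

namespace UniformSLLN

/-! ### E-processes and the uniform strong law -/

section Divergence

variable {Ω : Type*}

theorem valueAt_coe {E : ℕ → Ω → ℝ} {τ : Ω → WithTop ℕ} {ω : Ω} {n : ℕ} (h : τ ω = n) :
    ValueAt E τ ω = ENNReal.ofReal (E n ω) := by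
  simp only [ValueAt, h]
  rfl

theorem valueAt_top {E : ℕ → Ω → ℝ} {τ : Ω → WithTop ℕ} {ω : Ω} (h : τ ω = ⊤) :
    ValueAt E τ ω = limsup (fun n => ENNReal.ofReal (E n ω)) atTop := by
  simp only [ValueAt, h]

theorem divLattice_subset (X : ℕ → Ω → ℝ) (q : ℝ) (m : ℕ) (ε : ℝ) :
    DivLattice X q m ε ⊆
      {ω | ENNReal.ofReal ε ≤ ⨆ k : ℕ, ⨆ _ : m ≤ k, ENNReal.ofReal (NormSum X q k ω)} := by
  intro ω hω
  simp only [DivLattice, Set.mem_iUnion] at hω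
  obtain ⟨k, hk, h⟩ := hω
  exact (ENNReal.ofReal_le_ofReal h).trans
    (le_iSup₂ (f := fun k (_ : m ≤ k) => ENNReal.ofReal (NormSum X q k ω)) k hk)

/-- The supremum over `k` need not be attained, so passing to a single `k` costs a strict drop in
the level. -/
theorem subset_divLattice (X : ℕ → Ω → ℝ) (q : ℝ) (m : ℕ) {ε δ : ℝ} (hε : 0 < ε) (hδ : δ < ε) :
    {ω | ENNReal.ofReal ε ≤ ⨆ k : ℕ, ⨆ _ : m ≤ k, ENNReal.ofReal (NormSum X q k ω)} ⊆
      DivLattice X q m δ := by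
  intro ω hω
  have h : ENNReal.ofReal δ < ⨆ k : ℕ, ⨆ _ : m ≤ k, ENNReal.ofReal (NormSum X q k ω) :=
    lt_of_lt_of_le ((ENNReal.ofReal_lt_ofReal_iff hε).2 hδ) hω
  simp only [lt_iSup_iff] at h
  obtain ⟨k, hk, h⟩ := h
  simp only [DivLattice, Set.mem_iUnion]
  exact ⟨k, hk, (ENNReal.lt_ofReal_iff_toReal_lt (by simp)).1 h |>.le |> le_trans (by
    rw [ENNReal.toReal_ofReal']; exact le_max_left _ _)⟩

/-- The part of `DivLattice X q m ε` that has been observed by time `n`. -/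
def DivLatticeUpTo (X : ℕ → Ω → ℝ) (q : ℝ) (m : ℕ) (ε : ℝ) (n : ℕ) : Set Ω :=
  ⋃ k : ℕ, ⋃ _ : m ≤ k ∧ k ≤ n, {ω | ε ≤ NormSum X q k ω}

theorem divLatticeUpTo_subset (X : ℕ → Ω → ℝ) (q : ℝ) (m : ℕ) (ε : ℝ) (n : ℕ) :
    DivLatticeUpTo X q m ε n ⊆ DivLattice X q m ε := by
  intro ω hω
  simp only [DivLatticeUpTo, DivLattice, Set.mem_iUnion] at hω ⊢
  obtain ⟨k, hk, h⟩ := hω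
  exact ⟨k, hk.1, h⟩

theorem valueAt_le {E : ℕ → Ω → ℝ} (τ : Ω → WithTop ℕ) {ω : Ω} {c : ℝ≥0∞}
    (h : ∀ n, ENNReal.ofReal (E n ω) ≤ c) : ValueAt E τ ω ≤ c := by
  cases hτ : τ ω with
  | top =>
    rw [valueAt_top hτ]
    exact limsup_le_of_le (by isBoundedDefault) (Eventually.of_forall h)
  | coe n =>
    rw [valueAt_coe hτ]
    exact h n

/-- The process that counts how many of the events `DivLattice X q (M j) (1 / (j + 1))`, `j ≤ n`,
have been observed by time `n`. -/
noncomputable def CountProcess (X : ℕ → Ω → ℝ) (q : ℝ) (M : ℕ → ℕ) (n : ℕ) (ω : Ω) : ℝ :=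
  ∑ j ∈ Finset.range (n + 1), (DivLatticeUpTo X q (M j) (1 / ((j : ℝ) + 1)) n).indicator 1 ω

/-- A pathwise majorant independent of `n`: it also bounds the limsup, hence the value at an
infinite time. -/
theorem ofReal_countProcess_le (X : ℕ → Ω → ℝ) (q : ℝ) (M : ℕ → ℕ) (n : ℕ) (ω : Ω) :
    ENNReal.ofReal (CountProcess X q M n ω) ≤
      ∑' j : ℕ, (DivLattice X q (M j) (1 / ((j : ℝ) + 1))).indicator 1 ω := by
  have hnn : ∀ j ∈ Finset.range (n + 1),
      0 ≤ (DivLatticeUpTo X q (M j) (1 / ((j : ℝ) + 1)) n).indicator (1 : Ω → ℝ) ω :=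
    fun j _ => Set.indicator_nonneg (fun _ _ => zero_le_one) _
  rw [CountProcess, ENNReal.ofReal_sum_of_nonneg hnn]
  refine (Finset.sum_le_sum fun j _ => ?_).trans (ENNReal.sum_le_tsum (Finset.range (n + 1)))
  by_cases h : ω ∈ DivLatticeUpTo X q (M j) (1 / ((j : ℝ) + 1)) n
  · rw [Set.indicator_of_mem h, Set.indicator_of_mem (divLatticeUpTo_subset _ _ _ _ _ h)]
    simp
  · rw [Set.indicator_of_notMem h]
    simp

/-- One `k` witnessing the event at level `ε` and a large enough `m` witnesses all the counted
events with `j₀ ≤ j ≤ j₀ + K`, since `1 / (j + 1) ≤ ε` there. That makes `K + 1` of them. -/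
theorem divergesTailUniformly_countProcess (X : ℕ → Ω → ℝ) (q : ℝ) (M : ℕ → ℕ) :
    DivergesTailUniformly (CountProcess X q M) (DivLattice X q) := by
  intro ε hε
  rw [ENNReal.tendsto_nhds_top_iff_nat]
  intro K
  obtain ⟨j₀, hj₀⟩ := exists_nat_one_div_lt hε
  filter_upwards [eventually_ge_atTop ((Finset.range (j₀ + K + 1)).sup M)] with m hm
  have hKlt : (K : ℝ≥0∞) < ((K + 1 : ℕ) : ℝ≥0∞) := by exact_mod_cast K.lt_succ_self
  refine hKlt.trans_le (le_iInf₂ fun ω hω => ?_)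
  simp only [DivLattice, Set.mem_iUnion] at hω
  obtain ⟨k, hk, hω⟩ := hω
  -- Late enough both to have observed time `k` and to have admitted the indices up to `j₀ + K` into
  -- the count.
  refine le_iSup₂_of_le (max k (j₀ + K + 1)) (by omega) ?_
  rw [← ENNReal.ofReal_natCast]
  refine ENNReal.ofReal_le_ofReal ?_
  have hsub : Finset.Ico j₀ (j₀ + K + 1) ⊆ Finset.range (max k (j₀ + K + 1) + 1) := by
    intro j hj
    rw [Finset.mem_Ico] at hj
    rw [Finset.mem_range]
    omega
  refine le_trans ?_ (Finset.sum_le_sum_of_subset_of_nonneg hsub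
    fun j _ _ => Set.indicator_nonneg (fun _ _ => zero_le_one) _)
  have hone : ∀ j ∈ Finset.Ico j₀ (j₀ + K + 1),
      (DivLatticeUpTo X q (M j) (1 / ((j : ℝ) + 1)) (max k (j₀ + K + 1))).indicator
        (1 : Ω → ℝ) ω = 1 := by
    intro j hj
    rw [Finset.mem_Ico] at hj
    refine Set.indicator_of_mem ?_ _
    simp only [DivLatticeUpTo, Set.mem_iUnion]
    refine ⟨k, ⟨?_, le_max_left _ _⟩, ?_⟩
    · exact (Finset.le_sup (f := M) (Finset.mem_range.2 hj.2)).trans (hm.trans hk)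
    · refine le_trans ?_ (hj₀.le.trans hω)
      exact Nat.one_div_le_one_div hj.1
  rw [Finset.sum_congr rfl hone]
  simp [Nat.add_assoc]

variable [mΩ : MeasurableSpace Ω]

/-- Ville's inequality for e-processes. -/
theorem IsEProcess.measure_exists_ge_le {ℱ : Filtration ℕ mΩ} {Ps : Set (Measure Ω)}
    {E : ℕ → Ω → ℝ} (hE : IsEProcess ℱ Ps E) {P : Measure Ω} (hP : P ∈ Ps) {c : ℝ} (hc : 0 < c) :
    P {ω | ∃ n, c ≤ E n ω} ≤ (ENNReal.ofReal c)⁻¹ := by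
  have hmeas : MeasurableSet {ω | ∃ n, c ≤ E n ω} := by
    rw [Set.ofPred_exists]
    exact MeasurableSet.iUnion fun n =>
      measurableSet_le measurable_const ((hE.adapted n).mono (ℱ.le n) le_rfl)
  -- Stop when `E` first reaches `c`: the stopped value is at least `c` on the event.
  have hτ := hE.adapted.isStoppingTime_hittingAfter (s := Set.Ici c) (n := 0) measurableSet_Ici
  have h1 := hE.lintegral_le_one P hP _ hτ
  have h2 : ENNReal.ofReal c * P {ω | ∃ n, c ≤ E n ω} ≤ 1 := by
    rw [← lintegral_indicator_const hmeas]
    refine (lintegral_mono fun ω => ?_).trans h1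
    by_cases hω : ω ∈ {ω | ∃ n, c ≤ E n ω}
    · rw [Set.indicator_of_mem hω]
      obtain ⟨n, hn⟩ := hω
      have hmem := hittingAfter_mem_set (u := E) (s := Set.Ici c) (n := 0) (ω := ω)
        ⟨n, Nat.zero_le n, hn⟩
      cases hτ : hittingAfter E (Set.Ici c) 0 ω with
      | top =>
        exact absurd hn (hittingAfter_eq_top_iff.1 hτ n (Nat.zero_le n))
      | coe k =>
        rw [valueAt_coe hτ]
        rw [hτ] at hmem
        exact ENNReal.ofReal_le_ofReal hmem
    · rw [Set.indicator_of_notMem hω]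
      exact zero_le
  rw [← one_div, ENNReal.le_div_iff_mul_le (Or.inl (by simpa using hc)) (Or.inl (by simp)),
    mul_comm]
  exact h2

theorem uniformStrongLaw_of_isEProcess {ℱ : Filtration ℕ mΩ} {X : ℕ → Ω → ℝ} {q : ℝ}
    {Ps : Set (Measure Ω)} {E : ℕ → Ω → ℝ} (hE : IsEProcess ℱ Ps E)
    (hdiv : DivergesTailUniformly E (DivLattice X q)) : UniformStrongLaw X q Ps := by
  intro ε hε
  rw [ENNReal.tendsto_nhds_zero]
  intro δ hδ
  obtain ⟨n, hn⟩ := ENNReal.exists_inv_nat_lt hδ.ne'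
  -- Half of `ε` absorbs the unattained supremum; `n + 1` keeps the Ville threshold positive.
  have hn' := ENNReal.tendsto_nhds_top_iff_nat.1 (hdiv (ε / 2) (half_pos hε)) (n + 1)
  filter_upwards [hn'] with m hm
  refine iSup₂_le fun P hP => ?_
  have hsub : {ω | ENNReal.ofReal ε ≤ ⨆ k : ℕ, ⨆ _ : m ≤ k, ENNReal.ofReal (NormSum X q k ω)} ⊆
      {ω | ∃ k, ((n + 1 : ℕ) : ℝ) ≤ E k ω} := by
    intro ω hω
    have h1 := lt_of_lt_of_le hm (iInf₂_le ω (subset_divLattice X q m hε (half_lt_self hε) hω))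
    simp only [lt_iSup_iff] at h1
    obtain ⟨k, -, h1⟩ := h1
    refine ⟨k, ?_⟩
    rw [ENNReal.lt_ofReal_iff_toReal_lt (by finiteness)] at h1
    rw [ENNReal.toReal_natCast] at h1
    exact h1.le
  refine (measure_mono hsub).trans
    ((hE.measure_exists_ge_le hP (by positivity)).trans (le_trans ?_ hn.le))
  rw [ENNReal.ofReal_natCast, ENNReal.inv_le_inv]
  exact_mod_cast n.le_succ

theorem measurable_normSum {X : ℕ → Ω → ℝ} (hX : ∀ i, Measurable (X i)) (q : ℝ) {k n : ℕ}
    (hk : k ≤ n) : Measurable[GeneratedFiltration X hX n] (NormSum X q k) := by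
  have hi : ∀ i ∈ Finset.range k, Measurable[GeneratedFiltration X hX n] (X i) := by
    intro i hi
    rw [measurable_iff_comap_le]
    exact le_iSup₂_of_le i ((Finset.mem_range.1 hi).trans_le hk) le_rfl
  unfold NormSum PartialSum
  have hsum : Measurable[GeneratedFiltration X hX n] fun ω => ∑ i ∈ Finset.range k, X i ω :=
    @Finset.measurable_fun_sum _ _ _ _ _ _ (_) _ _ hi
  have habs : Measurable fun x : ℝ => |x| / (k : ℝ) ^ (1 / q) := by fun_prop
  exact habs.comp hsum

theorem measurableSet_divLattice {X : ℕ → Ω → ℝ} (hX : ∀ i, Measurable (X i)) (q : ℝ) (m : ℕ)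
    (ε : ℝ) : MeasurableSet (DivLattice X q m ε) := by
  refine MeasurableSet.iUnion fun k => MeasurableSet.iUnion fun _ => ?_
  exact measurableSet_le measurable_const
    ((measurable_normSum hX q le_rfl).mono ((GeneratedFiltration X hX).le k) le_rfl)

/-- The majorant has expectation at most `∑ 2⁻¹ ^ (j + 1) = 1`. -/
theorem isEProcess_countProcess {X : ℕ → Ω → ℝ} (hX : ∀ i, Measurable (X i)) {q : ℝ}
    {Ps : Set (Measure Ω)} {M : ℕ → ℕ}
    (hM : ∀ P ∈ Ps, ∀ j : ℕ, P (DivLattice X q (M j) (1 / ((j : ℝ) + 1))) ≤ 2⁻¹ ^ (j + 1)) :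
    IsEProcess (GeneratedFiltration X hX) Ps (CountProcess X q M) where
  adapted n := by
    unfold CountProcess
    refine Finset.measurable_fun_sum _ fun j _ => ?_
    refine Measurable.indicator (@measurable_one _ _ _ (_) _) ?_
    refine MeasurableSet.iUnion fun k => MeasurableSet.iUnion fun hk => ?_
    exact measurable_normSum hX q hk.2 measurableSet_Ici
  nonneg n ω := Finset.sum_nonneg fun j _ => Set.indicator_nonneg (fun _ _ => zero_le_one) _
  lintegral_le_one P hP τ _ := by
    calc ∫⁻ ω, ValueAt (CountProcess X q M) τ ω ∂P
        ≤ ∫⁻ ω, ∑' j : ℕ, (DivLattice X q (M j) (1 / ((j : ℝ) + 1))).indicator 1 ω ∂P :=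
          lintegral_mono fun ω => valueAt_le τ fun n => ofReal_countProcess_le X q M n ω
      _ = ∑' j : ℕ, P (DivLattice X q (M j) (1 / ((j : ℝ) + 1))) := by
          rw [lintegral_tsum fun j =>
            (measurable_one.indicator (measurableSet_divLattice hX q _ _)).aemeasurable]
          exact tsum_congr fun j => lintegral_indicator_one (measurableSet_divLattice hX q _ _)
      _ ≤ ∑' j : ℕ, (2⁻¹ : ℝ≥0∞) ^ (j + 1) := ENNReal.tsum_le_tsum fun j => hM P hP j
      _ = 1 := by
          rw [ENNReal.tsum_geometric_add_one, ENNReal.one_sub_inv_two, inv_inv]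
          exact ENNReal.inv_mul_cancel (by simp) (by simp)

theorem exists_isEProcess_of_uniformStrongLaw {X : ℕ → Ω → ℝ} (hX : ∀ i, Measurable (X i)) {q : ℝ}
    {Ps : Set (Measure Ω)} (h : UniformStrongLaw X q Ps) :
    ∃ E : ℕ → Ω → ℝ, IsEProcess (GeneratedFiltration X hX) Ps E ∧
      DivergesTailUniformly E (DivLattice X q) := by
  have hex : ∀ j : ℕ, ∃ m : ℕ, ∀ P ∈ Ps,
      P (DivLattice X q m (1 / ((j : ℝ) + 1))) ≤ 2⁻¹ ^ (j + 1) := by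
    intro j
    have h1 := ENNReal.tendsto_nhds_zero.1 (h (1 / ((j : ℝ) + 1)) (by positivity))
      (2⁻¹ ^ (j + 1)) (ENNReal.pow_pos (by simp) _)
    obtain ⟨m, hm⟩ := h1.exists
    exact ⟨m, fun P hP => (measure_mono (divLattice_subset X q m _)).trans
      ((le_iSup₂ (f := fun (P : Measure Ω) (_ : P ∈ Ps) => P {ω | ENNReal.ofReal _ ≤
        ⨆ k : ℕ, ⨆ _ : m ≤ k, ENNReal.ofReal (NormSum X q k ω)}) P hP).trans hm)⟩
  choose M hM using hex
  exact ⟨CountProcess X q M, isEProcess_countProcess hX fun P hP j => hM j P hP,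
    divergesTailUniformly_countProcess X q M⟩

end Divergence

end UniformSLLN

namespace UniformSLLN

/-! ### From the uniform strong law to uniform integrability -/

section Necessity

/-- A number exceeding `2 m + 2` is at most twice the number of integers `k + 1 > m` below it. -/
theorem ofReal_le_two_mul_tsum {m : ℕ} (y : ℝ) (hy : 2 * (m : ℝ) + 2 ≤ y) :
    ENNReal.ofReal y ≤ 2 * ∑' k : ℕ, if m ≤ k ∧ (k : ℝ) + 1 ≤ y then 1 else 0 := by
  have hy0 : 0 ≤ y := le_trans (by positivity) hy
  have hfl := Nat.sub_one_lt_floor y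
  have hsub : m ≤ ⌊y⌋₊ := Nat.le_floor (by linarith [(Nat.cast_nonneg m : (0 : ℝ) ≤ m)])
  -- The interval contains `⌊y⌋₊ - m > y - 1 - m ≥ y / 2` integers.
  refine le_trans ?_ (mul_le_mul_right (ENNReal.sum_le_tsum (Finset.Ico m ⌊y⌋₊)) 2)
  have hone : ∀ k ∈ Finset.Ico m ⌊y⌋₊,
      (if m ≤ k ∧ (k : ℝ) + 1 ≤ y then (1 : ℝ≥0∞) else 0) = 1 := by
    intro k hk
    rw [Finset.mem_Ico] at hk
    refine if_pos ⟨hk.1, ?_⟩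
    exact_mod_cast (Nat.le_floor_iff hy0).1 hk.2
  rw [Finset.sum_congr rfl hone, Finset.sum_const, Nat.card_Ico, nsmul_one,
    ← ENNReal.ofReal_natCast, ← ENNReal.ofReal_ofNat, ← ENNReal.ofReal_mul (by norm_num)]
  refine ENNReal.ofReal_le_ofReal ?_
  rw [Nat.cast_sub hsub]
  linarith

variable {Ω : Type*}

/-- `X k` is the increment from `S_k` to `S_{k+1}`, so one of these sums has absolute value at least
half of `(k + 1) ^ (1 / q)`. -/
theorem mem_divLattice_of_le_abs_rpow {X : ℕ → Ω → ℝ} {q : ℝ} (hq : 1 ≤ q) {ω : Ω} {m k : ℕ} (hm : 1 ≤ m)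
    (hk : m ≤ k) (h : (k : ℝ) + 1 ≤ |X k ω| ^ q) : ω ∈ DivLattice X q m (1 / 2) := by
  have hq0 : 0 < q := by linarith
  have h1 : ((k : ℝ) + 1) ^ (1 / q) ≤ |X k ω| := by
    rw [one_div, Real.rpow_inv_le_iff_of_pos (by positivity) (abs_nonneg _) hq0]
    exact h
  have hkpos : (0 : ℝ) < k := by exact_mod_cast (by omega : 0 < k)
  have hX : X k ω = PartialSum X (k + 1) ω - PartialSum X k ω := by
    simp [PartialSum, Finset.sum_range_succ]
  have habs : |X k ω| ≤ |PartialSum X (k + 1) ω| + |PartialSum X k ω| := by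
    rw [hX]
    exact abs_sub _ _
  have hmono : (k : ℝ) ^ (1 / q) ≤ ((k : ℝ) + 1) ^ (1 / q) := by
    gcongr
    linarith
  simp only [DivLattice, Set.mem_iUnion]
  by_cases hS : 1 / 2 * ((k : ℝ) + 1) ^ (1 / q) ≤ |PartialSum X (k + 1) ω|
  · refine ⟨k + 1, by omega, ?_⟩
    change _ ≤ NormSum X q (k + 1) ω
    rw [NormSum, le_div_iff₀ (by positivity)]
    push_cast
    exact hS
  · refine ⟨k, hk, ?_⟩
    change _ ≤ NormSum X q k ω
    rw [NormSum, le_div_iff₀ (by positivity)]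
    linarith

variable [mΩ : MeasurableSpace Ω]

/-- A quantitative second Borel–Cantelli lemma. With `t` the sum, independence gives `1 - δ ≤ exp
(-t)`; combined with `(1 + t) * exp (-t) ≤ 1` this yields `t ≤ δ / (1 - δ) ≤ 2 * δ`. -/
theorem sum_measure_le_of_iIndepFun {P : Measure Ω} [IsProbabilityMeasure P] {X : ℕ → Ω → ℝ}
    (hind : iIndepFun X P) (hX : ∀ i, Measurable (X i)) {B : ℕ → Set ℝ}
    (hB : ∀ i, MeasurableSet (B i)) {δ : ℝ} (hδ : δ ≤ 1 / 2) (s : Finset ℕ)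
    (h : P.real (⋃ i ∈ s, X i ⁻¹' B i) ≤ δ) : ∑ i ∈ s, P.real (X i ⁻¹' B i) ≤ 2 * δ := by
  have hinter : P (⋂ i ∈ s, X i ⁻¹' (B i)ᶜ) = ∏ i ∈ s, P (X i ⁻¹' (B i)ᶜ) :=
    hind.measure_inter_preimage_eq_mul s fun i _ => (hB i).compl
  have hreal : P.real (⋂ i ∈ s, X i ⁻¹' (B i)ᶜ) = ∏ i ∈ s, (1 - P.real (X i ⁻¹' B i)) := by
    rw [measureReal_def, hinter, ENNReal.toReal_prod]
    refine Finset.prod_congr rfl fun i _ => ?_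
    rw [Set.preimage_compl, ← measureReal_def, probReal_compl_eq_one_sub (hX i (hB i))]
  have hunion : MeasurableSet (⋃ i ∈ s, X i ⁻¹' B i) :=
    Finset.measurableSet_biUnion s fun i _ => hX i (hB i)
  have hcompl : P.real (⋂ i ∈ s, X i ⁻¹' (B i)ᶜ) = 1 - P.real (⋃ i ∈ s, X i ⁻¹' B i) := by
    rw [← probReal_compl_eq_one_sub hunion]
    simp only [Set.compl_iUnion, Set.preimage_compl]
  have hprod : ∏ i ∈ s, (1 - P.real (X i ⁻¹' B i)) ≤
      Real.exp (-∑ i ∈ s, P.real (X i ⁻¹' B i)) := by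
    rw [← Finset.sum_neg_distrib, Real.exp_sum]
    refine Finset.prod_le_prod (fun i _ => sub_nonneg.2 measureReal_le_one) fun i _ => ?_
    have := Real.add_one_le_exp (-P.real (X i ⁻¹' B i))
    linarith
  set t := ∑ i ∈ s, P.real (X i ⁻¹' B i)
  have h1 : 1 - δ ≤ Real.exp (-t) := by linarith
  have ht : 0 ≤ t := Finset.sum_nonneg fun i _ => measureReal_nonneg
  have h2 : (1 + t) * Real.exp (-t) ≤ 1 := by
    have := Real.add_one_le_exp t
    calc (1 + t) * Real.exp (-t) ≤ Real.exp t * Real.exp (-t) := by gcongr; linarith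
      _ = 1 := by rw [← Real.exp_add]; simp
  have h3 : (1 + t) * (1 - δ) ≤ 1 := (mul_le_mul_of_nonneg_left h1 (by linarith)).trans h2
  have hδ0 : 0 ≤ δ := measureReal_nonneg.trans h
  nlinarith

theorem tsum_measure_le {X : ℕ → Ω → ℝ} (hX : ∀ i, Measurable (X i)) {q : ℝ} (hq : 1 ≤ q)
    {P : Measure Ω} (hP : P ∈ MeanZeroIID X) {m : ℕ} (hm : 1 ≤ m) {δ : ℝ} (hδ : δ ≤ 1 / 2)
    (hδ0 : 0 ≤ δ)
    (h : P (DivLattice X q m (1 / 2)) ≤ ENNReal.ofReal δ) :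
    ∑' k : ℕ, (if m ≤ k then P {ω | (k : ℝ) + 1 ≤ |X 0 ω| ^ q} else 0) ≤
      ENNReal.ofReal (2 * δ) := by
  obtain ⟨hprob, hind, hid, -, -⟩ := hP
  refine ENNReal.tsum_le_of_sum_range_le fun n => ?_
  have hB : ∀ k : ℕ, MeasurableSet {x : ℝ | (k : ℝ) + 1 ≤ |x| ^ q} := fun k =>
    measurableSet_le measurable_const (by fun_prop)
  have hsub : (⋃ k ∈ (Finset.range n).filter (m ≤ ·), X k ⁻¹' {x : ℝ | (k : ℝ) + 1 ≤ |x| ^ q}) ⊆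
      DivLattice X q m (1 / 2) := by
    refine Set.iUnion₂_subset fun k hk ω hω => ?_
    exact mem_divLattice_of_le_abs_rpow hq hm (Finset.mem_filter.1 hk).2 hω
  have h1 := sum_measure_le_of_iIndepFun hind hX hB hδ ((Finset.range n).filter (m ≤ ·))
    (ENNReal.toReal_le_of_le_ofReal hδ0 ((measure_mono hsub).trans h))
  rw [← Finset.sum_filter]
  have h2 : ∀ k : ℕ, P {ω | (k : ℝ) + 1 ≤ |X 0 ω| ^ q} =
      ENNReal.ofReal (P.real (X k ⁻¹' {x : ℝ | (k : ℝ) + 1 ≤ |x| ^ q})) := by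
    intro k
    rw [ofReal_measureReal]
    exact ((hid k).measure_mem_eq (hB k)).symm
  rw [Finset.sum_congr rfl fun k _ => h2 k,
    ← ENNReal.ofReal_sum_of_nonneg fun k _ => measureReal_nonneg]
  exact ENNReal.ofReal_le_ofReal h1

/-- A discrete layer-cake bound: count the integer levels below `|X 0| ^ q`, then exchange sum and
integral. -/
theorem setLIntegral_le_tsum {X : ℕ → Ω → ℝ} (hX : ∀ i, Measurable (X i)) {q : ℝ}
    (P : Measure Ω) (m : ℕ) {x : ℝ} (hx : 2 * (m : ℝ) + 2 ≤ x) :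
    ∫⁻ ω in {ω | x ≤ |X 0 ω| ^ q}, ENNReal.ofReal (|X 0 ω| ^ q) ∂P ≤
      2 * ∑' k : ℕ, (if m ≤ k then P {ω | (k : ℝ) + 1 ≤ |X 0 ω| ^ q} else 0) := by
  have hY : Measurable fun ω => |X 0 ω| ^ q := by
    have := hX 0
    fun_prop
  have hset : ∀ c : ℝ, MeasurableSet {ω | c ≤ |X 0 ω| ^ q} := fun c =>
    measurableSet_le measurable_const hY
  have hmeas : ∀ k : ℕ, Measurable fun ω =>
      if m ≤ k ∧ (k : ℝ) + 1 ≤ |X 0 ω| ^ q then (1 : ℝ≥0∞) else 0 := by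
    intro k
    refine Measurable.ite ?_ measurable_const measurable_const
    exact (MeasurableSet.const _).inter (hset _)
  calc ∫⁻ ω in {ω | x ≤ |X 0 ω| ^ q}, ENNReal.ofReal (|X 0 ω| ^ q) ∂P
      ≤ ∫⁻ ω in {ω | x ≤ |X 0 ω| ^ q},
          2 * ∑' k : ℕ, (if m ≤ k ∧ (k : ℝ) + 1 ≤ |X 0 ω| ^ q then 1 else 0) ∂P :=
        setLIntegral_mono' (hset x) fun ω hω => ofReal_le_two_mul_tsum _ (hx.trans hω)
    _ ≤ ∫⁻ ω, 2 * ∑' k : ℕ, (if m ≤ k ∧ (k : ℝ) + 1 ≤ |X 0 ω| ^ q then 1 else 0) ∂P :=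
        setLIntegral_le_lintegral _ _
    _ = 2 * ∑' k : ℕ, (if m ≤ k then P {ω | (k : ℝ) + 1 ≤ |X 0 ω| ^ q} else 0) := by
        rw [lintegral_const_mul _ (Measurable.tsum hmeas),
          lintegral_tsum fun k => (hmeas k).aemeasurable]
        congr 1
        refine tsum_congr fun k => ?_
        by_cases hk : m ≤ k
        · simp only [hk, true_and, if_true]
          rw [← lintegral_indicator_one (hset _)]
          rfl
        · simp [hk]

theorem unifIntegrableMoment_of_uniformStrongLaw {X : ℕ → Ω → ℝ} (hX : ∀ i, Measurable (X i))
    {q : ℝ} (hq : 1 ≤ q) {Ps : Set (Measure Ω)} (hPs : Ps ⊆ MeanZeroIID X)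
    (h : UniformStrongLaw X q Ps) : UnifIntegrableMoment X q Ps := by
  rw [UnifIntegrableMoment, ENNReal.tendsto_nhds_zero]
  intro η hη
  obtain ⟨δ, hδ0, hδ, hδη⟩ : ∃ δ : ℝ, 0 < δ ∧ δ ≤ 1 / 2 ∧ 2 * ENNReal.ofReal (2 * δ) ≤ η := by
    rcases eq_or_ne η ⊤ with rfl | hη'
    · exact ⟨1 / 2, by norm_num, le_rfl, le_top⟩
    · have hpos : 0 < η.toReal := ENNReal.toReal_pos hη.ne' hη'
      refine ⟨min (1 / 2) (η.toReal / 4), by positivity, min_le_left _ _, ?_⟩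
      rw [← ENNReal.ofReal_ofNat, ← ENNReal.ofReal_mul (by norm_num)]
      refine ENNReal.ofReal_le_of_le_toReal ?_
      have := min_le_right (1 / 2) (η.toReal / 4)
      linarith
  have h1 := ENNReal.tendsto_nhds_zero.1 (h (1 / 2) (by norm_num)) (ENNReal.ofReal δ)
    (ENNReal.ofReal_pos.2 hδ0)
  obtain ⟨m, hm, hm1⟩ := (h1.and (eventually_ge_atTop 1)).exists
  filter_upwards [eventually_ge_atTop (2 * (m : ℝ) + 2)] with x hx
  refine iSup₂_le fun P hP => ?_
  have h2 : P (DivLattice X q m (1 / 2)) ≤ ENNReal.ofReal δ :=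
    (measure_mono (divLattice_subset X q m _)).trans
      ((le_iSup₂ (f := fun (P : Measure Ω) (_ : P ∈ Ps) => P {ω | ENNReal.ofReal _ ≤
        ⨆ k : ℕ, ⨆ _ : m ≤ k, ENNReal.ofReal (NormSum X q k ω)}) P hP).trans hm)
  refine (setLIntegral_le_tsum hX P m hx).trans (le_trans ?_ hδη)
  gcongr
  exact tsum_measure_le hX hq (hPs hP) hm1 hδ hδ0.le h2

end Necessity

end UniformSLLN

namespace UniformSLLN

/-! ### Kolmogorov's maximal inequality -/

section Maximal

variable {Ω : Type*} [mΩ : MeasurableSpace Ω] {P : Measure Ω} {ξ : ℕ → Ω → ℝ}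

theorem memLp_sum_range (hL : ∀ i, MemLp (ξ i) 2 P) (n : ℕ) :
    MemLp (fun ω => ∑ i ∈ Finset.range n, ξ i ω) 2 P :=
  memLp_finsetSum _ fun i _ => hL i

/-- The squared partial sums of independent centred square-integrable variables form a
submartingale. -/
theorem submartingale_sq_sum [IsProbabilityMeasure P] (hind : iIndepFun ξ P)
    (hm : ∀ i, StronglyMeasurable (ξ i)) (hL : ∀ i, MemLp (ξ i) 2 P)
    (h0 : ∀ i, ∫ ω, ξ i ω ∂P = 0) :
    Submartingale (fun n ω => (∑ i ∈ Finset.range (n + 1), ξ i ω) ^ 2)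
      (Filtration.natural ξ hm) P := by
  have hadp : ∀ n, Measurable[Filtration.natural ξ hm n]
      fun ω => ∑ i ∈ Finset.range (n + 1), ξ i ω := by
    intro n
    refine @Finset.measurable_fun_sum _ _ _ _ _ _ (_) _ _ fun i hi => ?_
    rw [measurable_iff_comap_le]
    exact le_iSup₂_of_le i (Nat.lt_succ_iff.1 (Finset.mem_range.1 hi)) le_rfl
  refine submartingale_of_setIntegral_le_succ (fun n => ?_)
    (fun n => (memLp_sum_range hL _).integrable_sq) fun n s hs => ?_
  · exact ((measurable_id.pow_const 2).comp (hadp n)).stronglyMeasurable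
  · have hs' := (Filtration.natural ξ hm).le n s hs
    set S : Ω → ℝ := fun ω => ∑ i ∈ Finset.range (n + 1), ξ i ω with hS
    have hSL : MemLp S 2 P := memLp_sum_range hL _
    have hexp : ∀ ω, (∑ i ∈ Finset.range (n + 1 + 1), ξ i ω) ^ 2 =
        S ω ^ 2 + (2 * (S ω * ξ (n + 1) ω) + ξ (n + 1) ω ^ 2) := by
      intro ω
      rw [Finset.sum_range_succ]
      ring
    have hint : Integrable (fun ω => S ω * ξ (n + 1) ω) P := hSL.integrable_mul (hL (n + 1))
    have hint2 : Integrable (fun ω => ξ (n + 1) ω ^ 2) P := (hL (n + 1)).integrable_sq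
    -- The cross term vanishes: `s.indicator S` is measurable with respect to the past, hence
    -- independent of the centred `ξ (n + 1)`.
    have hcross : ∫ ω in s, S ω * ξ (n + 1) ω ∂P = 0 := by
      have hindep : IndepFun (s.indicator S) (ξ (n + 1)) P := by
        rw [IndepFun_iff_Indep]
        refine indep_of_indep_of_le_left
          (hind.indep_comap_natural_of_lt hm (Nat.lt_succ_self n)).symm ?_
        rw [← measurable_iff_comap_le]
        exact (hadp n).indicator hs
      rw [← integral_indicator hs']
      have : (s.indicator fun ω => S ω * ξ (n + 1) ω) = fun ω => s.indicator S ω * ξ (n + 1) ω := by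
        ext ω
        exact Set.indicator_mul_left _ _ _
      rw [this, hindep.integral_fun_mul_eq_mul_integral
        (hSL.aestronglyMeasurable.indicator hs') (hL _).aestronglyMeasurable, h0, mul_zero]
    simp only [hexp]
    have hint3 : Integrable (fun ω => 2 * (S ω * ξ (n + 1) ω)) P := hint.const_mul 2
    have hint4 : Integrable (fun ω => 2 * (S ω * ξ (n + 1) ω) + ξ (n + 1) ω ^ 2) P :=
      hint3.add hint2
    rw [integral_add (hSL.integrable_sq.integrableOn (s := s)) hint4.integrableOn,
      integral_add hint3.integrableOn hint2.integrableOn, integral_const_mul, hcross]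
    change ∫ ω in s, S ω ^ 2 ∂P ≤ _
    have : 0 ≤ ∫ ω in s, ξ (n + 1) ω ^ 2 ∂P := integral_nonneg fun ω => sq_nonneg _
    linarith

/-- Kolmogorov's maximal inequality. -/
theorem measure_exists_le_abs_sum_le [IsProbabilityMeasure P] (hind : iIndepFun ξ P)
    (hm : ∀ i, StronglyMeasurable (ξ i)) (hL : ∀ i, MemLp (ξ i) 2 P)
    (h0 : ∀ i, ∫ ω, ξ i ω ∂P = 0) {t : ℝ} (ht : 0 < t) (n : ℕ) :
    P {ω | ∃ k ≤ n, t ≤ |∑ i ∈ Finset.range k, ξ i ω|} ≤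
      ENNReal.ofReal ((∑ i ∈ Finset.range n, ∫ ω, ξ i ω ^ 2 ∂P) / t ^ 2) := by
  rcases n with _ | n
  · refine le_of_eq_of_le ?_ zero_le
    convert measure_empty (μ := P)
    ext ω
    simp [ht]
  have hsub := submartingale_sq_sum hind hm hL h0
  -- Doob's inequality at height `t ^ 2`; index `n` of the submartingale is the sum of `n + 1`
  -- terms, hence the separate empty case.
  have hmax := maximal_ineq hsub (fun n ω => sq_nonneg _) (ε := (t ^ 2).toNNReal) n
  rw [Real.coe_toNNReal _ (sq_nonneg t)] at hmax
  set A := {ω | t ^ 2 ≤ (Finset.range (n + 1)).sup' Finset.nonempty_range_add_one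
      fun k => (∑ i ∈ Finset.range (k + 1), ξ i ω) ^ 2} with hA
  have hsubset : {ω | ∃ k ≤ n + 1, t ≤ |∑ i ∈ Finset.range k, ξ i ω|} ⊆ A := by
    rintro ω ⟨k, hk, hkt⟩
    rcases k with _ | k
    · simp at hkt
      linarith
    · refine le_trans ?_ (Finset.le_sup' (fun k => (∑ i ∈ Finset.range (k + 1), ξ i ω) ^ 2)
        (Finset.mem_range.2 hk))
      rw [← sq_abs (∑ i ∈ Finset.range (k + 1), ξ i ω)]
      gcongr
  have hvar : ∫ ω, (∑ i ∈ Finset.range (n + 1), ξ i ω) ^ 2 ∂P =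
      ∑ i ∈ Finset.range (n + 1), ∫ ω, ξ i ω ^ 2 ∂P := by
    have h1 := IndepFun.variance_sum (μ := P) (X := ξ) (s := Finset.range (n + 1))
      (fun i _ => hL i) fun i _ j _ hij => hind.indepFun hij
    rw [variance_eq_integral (memLp_finsetSum' _ fun i _ => hL i).aestronglyMeasurable.aemeasurable]
      at h1
    have h2 : ∀ i ∈ Finset.range (n + 1), variance (ξ i) P = ∫ ω, ξ i ω ^ 2 ∂P := by
      intro i _
      rw [variance_eq_integral (hL i).aestronglyMeasurable.aemeasurable, h0]
      simp
    rw [Finset.sum_congr rfl h2] at h1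
    rw [← h1]
    have h3 : ∫ ω, (∑ i ∈ Finset.range (n + 1), ξ i) ω ∂P = 0 := by
      simp only [Finset.sum_apply]
      rw [integral_finsetSum _ fun i _ => (hL i).integrable one_le_two]
      exact Finset.sum_eq_zero fun i _ => h0 i
    rw [h3]
    simp
  have hle : ENNReal.ofReal (t ^ 2) * P A ≤
      ENNReal.ofReal (∑ i ∈ Finset.range (n + 1), ∫ ω, ξ i ω ^ 2 ∂P) := by
    refine hmax.trans (ENNReal.ofReal_le_ofReal ?_)
    rw [← hvar]
    exact setIntegral_le_integral (memLp_sum_range hL _).integrable_sq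
      (Eventually.of_forall fun ω => sq_nonneg _)
  refine (measure_mono hsubset).trans ?_
  rw [ENNReal.ofReal_div_of_pos (by positivity),
    ENNReal.le_div_iff_mul_le (Or.inl (by simpa using ht.ne'))
      (Or.inl (by simp)), mul_comm]
  exact hle

end Maximal

end UniformSLLN

namespace UniformSLLN

/-! ### Dyadic sums, truncation and the truncated maximal inequality -/

section Sufficiency

/-- A geometric sum is at most twice its largest term, here at most `2 * z`. -/
theorem sum_two_pow_le {z : ℝ} (hz : 0 ≤ z) (n : ℕ) :
    ∑ j ∈ Finset.range n, (if (2 : ℝ) ^ j ≤ z then (2 : ℝ) ^ (j + 1) else 0) ≤ 4 * z := by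
  induction n with
  | zero => simpa using hz
  | succ n ih =>
    by_cases h : (2 : ℝ) ^ n ≤ z
    · have h1 : ∀ m : ℕ, ∑ j ∈ Finset.range m, (if (2 : ℝ) ^ j ≤ z then (2 : ℝ) ^ (j + 1) else 0) ≤
          2 ^ (m + 1) := by
        intro m
        induction m with
        | zero => simp
        | succ m ihm =>
          rw [Finset.sum_range_succ]
          have : (if (2 : ℝ) ^ m ≤ z then (2 : ℝ) ^ (m + 1) else 0) ≤ 2 ^ (m + 1) := by
            split_ifs
            · exact le_rfl
            · positivity
          rw [pow_succ _ (m + 1)]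
          linarith
      refine (h1 (n + 1)).trans ?_
      rw [pow_succ, pow_succ]
      linarith
    · rw [Finset.sum_range_succ, if_neg h, add_zero]
      exact ih

theorem sum_two_pow_tail_le {z : ℝ} (hz : 0 ≤ z) (J n : ℕ) :
    ∑ j ∈ Finset.range n, (if J ≤ j ∧ (2 : ℝ) ^ j ≤ z then (2 : ℝ) ^ (j + 1) else 0) ≤
      if (2 : ℝ) ^ J ≤ z then 4 * z else 0 := by
  split_ifs with h
  · refine (Finset.sum_le_sum fun j _ => ?_).trans (sum_two_pow_le hz n)
    split_ifs with h1 h2 h3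
    · exact le_rfl
    · exact absurd h1.2 h2
    · positivity
    · exact le_rfl
  · refine (Finset.sum_eq_zero fun j _ => if_neg ?_).le
    rintro ⟨h1, h2⟩
    exact h (le_trans (pow_le_pow_right₀ one_le_two h1) h2)

theorem sum_pow_tail_le {r : ℝ} (hr0 : 0 ≤ r) (hr1 : r < 1) (K n : ℕ) {p : ℕ → Prop}
    [DecidablePred p] (hp : ∀ j, p j → K ≤ j) :
    ∑ j ∈ Finset.range n, (if p j then r ^ j else 0) ≤ r ^ K / (1 - r) := by
  refine le_trans ?_ (geom_sum_Ico_le_of_lt_one hr0 hr1 (m := K) (n := n))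
  rw [← Finset.sum_filter]
  refine Finset.sum_le_sum_of_subset_of_nonneg (fun j hj => ?_) fun j _ _ => pow_nonneg hr0 j
  rw [Finset.mem_filter, Finset.mem_range] at hj
  exact Finset.mem_Ico.2 ⟨hp j hj.2, hj.1⟩

theorem two_rpow_lt_one {q : ℝ} (hq : 1 ≤ q) (hq2 : q < 2) : (2 : ℝ) ^ (1 - 2 / q) < 1 := by
  refine Real.rpow_lt_one_of_one_lt_of_neg one_lt_two ?_
  have : 1 < 2 / q := by
    rw [lt_div_iff₀ (by linarith)]
    linarith
  linarith

/-- Put `r = 2 ^ (1 - 2 / q) < 1`. If `b ≤ y ^ q`, the series starts no earlier than the first `j`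
with `y ^ q < 2 ^ j`, where `r ^ j * y ^ 2 ≤ y ^ q`. Otherwise it starts no earlier than `J`, and `y
^ 2 ≤ b ^ (2 / q - 1) * y ^ q`. The first case is charged to the tail; the second carries the small
factor `r ^ J`. -/
theorem sum_rpow_mul_sq_le {q : ℝ} (hq : 1 ≤ q) (hq2 : q < 2) {b : ℝ} (hb : 0 < b) {y : ℝ}
    (hy : 0 ≤ y) (J n : ℕ) :
    (∑ j ∈ Finset.range n,
      (if J ≤ j ∧ y ^ q < 2 ^ j then ((2 : ℝ) ^ (1 - 2 / q)) ^ j else 0)) * y ^ 2 ≤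
      (1 - (2 : ℝ) ^ (1 - 2 / q))⁻¹ * ((if b ≤ y ^ q then y ^ q else 0) +
        ((2 : ℝ) ^ (1 - 2 / q)) ^ J * b ^ (2 / q - 1) * y ^ q) := by
  have hq0 : 0 < q := by linarith
  have hr1 := two_rpow_lt_one hq hq2
  have hr0 : (0 : ℝ) ≤ 2 ^ (1 - 2 / q) := by positivity
  have hexp : 0 < 2 / q - 1 := by
    have : 1 < 2 / q := by
      rw [lt_div_iff₀ hq0]
      linarith
    linarith
  have hinv : 0 < (1 - (2 : ℝ) ^ (1 - 2 / q))⁻¹ := inv_pos.2 (by linarith)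
  have hyq : 0 ≤ y ^ q := Real.rpow_nonneg hy q
  have hsq : y ^ 2 = (y ^ q) ^ (2 / q) := by
    rw [← Real.rpow_mul hy, mul_div_cancel₀ _ hq0.ne', Real.rpow_two]
  by_cases h : b ≤ y ^ q
  · rw [if_pos h]
    have hpos : 0 < y ^ q := hb.trans_le h
    have hex : ∃ j : ℕ, y ^ q < 2 ^ j := pow_unbounded_of_one_lt _ one_lt_two
    classical
    have h1 := sum_pow_tail_le hr0 hr1 (Nat.find hex) n
      (p := fun j => J ≤ j ∧ y ^ q < 2 ^ j) fun j hj => Nat.find_min' hex hj.2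
    have h2 : ((2 : ℝ) ^ (1 - 2 / q)) ^ Nat.find hex ≤ (y ^ q) ^ (1 - 2 / q) := by
      rw [← Real.rpow_natCast, ← Real.rpow_mul zero_le_two, mul_comm, Real.rpow_mul zero_le_two,
        Real.rpow_natCast]
      exact Real.rpow_le_rpow_of_nonpos hpos (Nat.find_spec hex).le (by linarith)
    have h3 : (y ^ q) ^ (1 - 2 / q) * y ^ 2 = y ^ q := by
      rw [hsq, ← Real.rpow_add hpos]
      simp
    calc _ ≤ ((2 : ℝ) ^ (1 - 2 / q)) ^ Nat.find hex / (1 - (2 : ℝ) ^ (1 - 2 / q)) * y ^ 2 := by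
          refine mul_le_mul_of_nonneg_right (le_trans (le_of_eq ?_) h1) (sq_nonneg y)
          exact Finset.sum_congr rfl fun j _ => by congr
      _ = (1 - (2 : ℝ) ^ (1 - 2 / q))⁻¹ * (((2 : ℝ) ^ (1 - 2 / q)) ^ Nat.find hex * y ^ 2) := by
          rw [div_eq_mul_inv]
          ring
      _ ≤ (1 - (2 : ℝ) ^ (1 - 2 / q))⁻¹ * ((y ^ q) ^ (1 - 2 / q) * y ^ 2) := by gcongr
      _ ≤ _ := by
          rw [h3]
          gcongr
          have : 0 ≤ ((2 : ℝ) ^ (1 - 2 / q)) ^ J * b ^ (2 / q - 1) * y ^ q := by positivity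
          linarith
  · rw [if_neg h, zero_add]
    push Not at h
    have h1 := sum_pow_tail_le hr0 hr1 J n
      (p := fun j => J ≤ j ∧ y ^ q < 2 ^ j) fun j hj => hj.1
    have h2 : y ^ 2 ≤ b ^ (2 / q - 1) * y ^ q := by
      rcases hyq.eq_or_lt with h0 | hpos
      · rw [hsq, ← h0, Real.zero_rpow (by positivity), mul_zero]
      · calc y ^ 2 = (y ^ q) ^ (2 / q - 1) * y ^ q := by
              rw [hsq, ← Real.rpow_add_one hpos.ne']
              ring_nf
          _ ≤ _ := by gcongr
    calc _ ≤ ((2 : ℝ) ^ (1 - 2 / q)) ^ J / (1 - (2 : ℝ) ^ (1 - 2 / q)) * y ^ 2 :=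
          mul_le_mul_of_nonneg_right h1 (sq_nonneg y)
      _ = (1 - (2 : ℝ) ^ (1 - 2 / q))⁻¹ * (((2 : ℝ) ^ (1 - 2 / q)) ^ J * y ^ 2) := by
          rw [div_eq_mul_inv]
          ring
      _ ≤ _ := by
          rw [mul_assoc (_ ^ J)]
          gcongr

/-- Truncation of `x` to the region `|x| ^ q < a`. -/
noncomputable def truncAt (q a x : ℝ) : ℝ := if |x| ^ q < a then x else 0

theorem measurable_truncAt (q a : ℝ) : Measurable (truncAt q a) :=
  Measurable.ite (measurableSet_lt (by fun_prop) measurable_const) measurable_id measurable_const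

theorem truncAt_sq (q a x : ℝ) : truncAt q a x ^ 2 = if |x| ^ q < a then |x| ^ 2 else 0 := by
  unfold truncAt
  split_ifs <;> simp

theorem abs_truncAt_le {q a : ℝ} (hq : 0 < q) (ha : 0 < a) (x : ℝ) :
    |truncAt q a x| ≤ a ^ (1 / q) := by
  unfold truncAt
  split_ifs with h
  · rw [one_div, Real.le_rpow_inv_iff_of_pos (abs_nonneg _) ha.le hq]
    exact h.le
  · rw [abs_zero]
    positivity

variable {Ω : Type*} [mΩ : MeasurableSpace Ω]

/-- As `Z` is centred, the truncated mean is minus the integral over the discarded region, where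
`|Z| ≤ a ^ (1 / q - 1) * |Z| ^ q` because `1 / q - 1 ≤ 0`. -/
theorem abs_integral_truncAt_le {P : Measure Ω} {Z : Ω → ℝ} (hZ : Measurable Z)
    (hint : Integrable Z P) (h0 : ∫ ω, Z ω ∂P = 0) {q : ℝ} (hq : 1 ≤ q) {a : ℝ} (ha : 0 < a)
    {u : ℝ} (hu : 0 ≤ u)
    (hUI : ∫⁻ ω in {ω | a ≤ |Z ω| ^ q}, ENNReal.ofReal (|Z ω| ^ q) ∂P ≤ ENNReal.ofReal u) :
    |∫ ω, truncAt q a (Z ω) ∂P| ≤ a ^ (1 / q - 1) * u := by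
  have hq0 : 0 < q := by linarith
  set B := {ω | a ≤ |Z ω| ^ q}
  have hB : MeasurableSet B := measurableSet_le measurable_const (by fun_prop)
  have hsplit : (fun ω => truncAt q a (Z ω)) = Bᶜ.indicator Z := by
    ext ω
    by_cases h : |Z ω| ^ q < a
    · rw [Set.indicator_of_mem (by simpa [B] using h), truncAt, if_pos h]
    · rw [Set.indicator_of_notMem (by simpa [B] using h), truncAt, if_neg h]
  have hneg : ∫ ω, truncAt q a (Z ω) ∂P = -∫ ω in B, Z ω ∂P := by
    rw [hsplit, integral_indicator hB.compl, eq_neg_iff_add_eq_zero, add_comm,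
      integral_add_compl hB hint, h0]
  rw [hneg, abs_neg, ← ENNReal.ofReal_le_ofReal_iff (by positivity)]
  calc ENNReal.ofReal |∫ ω in B, Z ω ∂P| = ‖∫ ω in B, Z ω ∂P‖ₑ :=
        (Real.enorm_eq_ofReal_abs _).symm
    _ ≤ ∫⁻ ω in B, ‖Z ω‖ₑ ∂P := enorm_integral_le_lintegral_enorm _
    _ ≤ ∫⁻ ω in B, ENNReal.ofReal (a ^ (1 / q - 1)) * ENNReal.ofReal (|Z ω| ^ q) ∂P := by
        refine setLIntegral_mono' hB fun ω hω => ?_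
        rw [Real.enorm_eq_ofReal_abs, ← ENNReal.ofReal_mul (by positivity)]
        refine ENNReal.ofReal_le_ofReal ?_
        have hω' : a ≤ |Z ω| ^ q := hω
        have hpos : 0 < |Z ω| ^ q := ha.trans_le hω'
        calc |Z ω| = (|Z ω| ^ q) ^ (1 / q - 1) * |Z ω| ^ q := by
              rw [← Real.rpow_add_one hpos.ne', sub_add_cancel, ← Real.rpow_mul (abs_nonneg _),
                mul_one_div_cancel hq0.ne', Real.rpow_one]
          _ ≤ a ^ (1 / q - 1) * |Z ω| ^ q := by
              refine mul_le_mul_of_nonneg_right ?_ hpos.le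
              refine Real.rpow_le_rpow_of_nonpos ha hω' ?_
              rw [sub_nonpos, div_le_one hq0]
              exact hq
    _ = ENNReal.ofReal (a ^ (1 / q - 1)) * ∫⁻ ω in B, ENNReal.ofReal (|Z ω| ^ q) ∂P :=
        lintegral_const_mul _ (by fun_prop)
    _ ≤ _ := by
        rw [ENNReal.ofReal_mul (by positivity)]
        gcongr

/-- A maximal inequality for the partial sums, with truncation at level `a`. -/
theorem measure_exists_le_abs_partialSum_le {X : ℕ → Ω → ℝ} (hX : ∀ i, Measurable (X i))
    {P : Measure Ω} (hP : P ∈ MeanZeroIID X) {q : ℝ} (hq : 1 ≤ q) {a t : ℝ} (ha : 0 < a)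
    (ht : 0 < t) {N : ℕ} (hshift : N * |∫ ω, truncAt q a (X 0 ω) ∂P| ≤ t / 2) :
    P {ω | ∃ k ≤ N, t ≤ |PartialSum X k ω|} ≤
      N * P {ω | a ≤ |X 0 ω| ^ q} +
        ENNReal.ofReal (4 * N / t ^ 2) * ∫⁻ ω, ENNReal.ofReal (truncAt q a (X 0 ω) ^ 2) ∂P := by
  obtain ⟨hprob, hind, hid, -, -⟩ := hP
  have hφ := measurable_truncAt q a
  set c := ∫ ω, truncAt q a (X 0 ω) ∂P with hc
  set ξ : ℕ → Ω → ℝ := fun i ω => truncAt q a (X i ω) - c with hξ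
  have hφX : ∀ i, Measurable fun ω => truncAt q a (X i ω) := fun i => hφ.comp (hX i)
  have hφL : ∀ i, MemLp (fun ω => truncAt q a (X i ω)) 2 P := fun i =>
    MemLp.of_bound (hφX i).aestronglyMeasurable (a ^ (1 / q)) (Eventually.of_forall fun ω =>
      abs_truncAt_le (by linarith) ha _)
  have hξm : ∀ i, Measurable (ξ i) := fun i => (hφX i).sub_const c
  have hξL : ∀ i, MemLp (ξ i) 2 P := fun i => (hφL i).sub (memLp_const c)
  have hidφ : ∀ i, IdentDistrib (fun ω => truncAt q a (X i ω)) (fun ω => truncAt q a (X 0 ω)) P P :=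
    fun i => (hid i).comp hφ
  have hξ0 : ∀ i, ∫ ω, ξ i ω ∂P = 0 := by
    intro i
    simp only [hξ]
    rw [integral_sub ((hφL i).integrable one_le_two) (integrable_const c),
      (hidφ i).integral_eq]
    simp [hc]
  have hξind : iIndepFun ξ P := hind.comp (fun _ x => truncAt q a x - c) fun _ => hφ.sub_const c
  have hmax := measure_exists_le_abs_sum_le hξind (fun i => (hξm i).stronglyMeasurable) hξL hξ0
    (half_pos ht) N
  have hξsq : ∀ i ∈ Finset.range N, ∫ ω, ξ i ω ^ 2 ∂P ≤ ∫ ω, truncAt q a (X 0 ω) ^ 2 ∂P := by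
    intro i _
    have h1 := variance_le_expectation_sq (hφX i).aestronglyMeasurable (μ := P)
    rw [variance_eq_integral (hφX i).aemeasurable, (hidφ i).integral_eq] at h1
    refine h1.trans (le_of_eq ?_)
    exact ((hidφ i).comp (measurable_id.pow_const 2)).integral_eq
  have hsub : {ω | ∃ k ≤ N, t ≤ |PartialSum X k ω|} ⊆
      (⋃ i ∈ Finset.range N, {ω | a ≤ |X i ω| ^ q}) ∪
        {ω | ∃ k ≤ N, t / 2 ≤ |∑ i ∈ Finset.range k, ξ i ω|} := by
    rintro ω ⟨k, hk, hkt⟩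
    by_cases h : ∃ i < N, a ≤ |X i ω| ^ q
    · left
      obtain ⟨i, hi, h⟩ := h
      exact Set.mem_biUnion (Finset.mem_coe.2 (Finset.mem_range.2 hi)) h
    · right
      push Not at h
      refine ⟨k, hk, ?_⟩
      -- With no summand truncated, the drift `k * c` uses at most `t / 2`, so the centred sum must
      -- supply the other half.
      have hsum : PartialSum X k ω = (∑ i ∈ Finset.range k, ξ i ω) + k * c := by
        simp only [hξ, Finset.sum_sub_distrib, Finset.sum_const, Finset.card_range, nsmul_eq_mul,
          sub_add_cancel]
        refine Finset.sum_congr rfl fun i hi => ?_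
        rw [truncAt, if_pos (h i ((Finset.mem_range.1 hi).trans_le hk))]
      have hkc : |k * c| ≤ t / 2 := by
        rw [abs_mul, Nat.abs_cast]
        refine le_trans ?_ hshift
        gcongr
      rw [hsum] at hkt
      have := abs_add_le (∑ i ∈ Finset.range k, ξ i ω) (k * c)
      linarith
  refine (measure_mono hsub).trans ((measure_union_le _ _).trans (add_le_add ?_ ?_))
  · refine (measure_biUnion_finset_le _ _).trans (le_of_eq ?_)
    have hB : MeasurableSet {x : ℝ | a ≤ |x| ^ q} :=
      measurableSet_le measurable_const (by fun_prop)
    have : ∀ i ∈ Finset.range N, P {ω | a ≤ |X i ω| ^ q} = P {ω | a ≤ |X 0 ω| ^ q} :=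
      fun i _ => (hid i).measure_mem_eq hB
    rw [Finset.sum_congr rfl this, Finset.sum_const, Finset.card_range, nsmul_eq_mul]
  · refine hmax.trans ?_
    rw [← ofReal_integral_eq_lintegral_ofReal (hφL 0).integrable_sq
      (Eventually.of_forall fun ω => sq_nonneg _), ← ENNReal.ofReal_mul (by positivity)]
    refine ENNReal.ofReal_le_ofReal ?_
    have hsum := Finset.sum_le_sum hξsq
    rw [Finset.sum_const, Finset.card_range, nsmul_eq_mul] at hsum
    calc _ ≤ (N * ∫ ω, truncAt q a (X 0 ω) ^ 2 ∂P) / (t / 2) ^ 2 := by gcongr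
      _ = _ := by
        field_simp
        ring

end Sufficiency

end UniformSLLN

namespace UniformSLLN

/-! ### Dyadic blocks and the uniform strong law -/

section UniformLaw

/-- The summand that dominates the contribution of the `j`-th dyadic block, as a function of
`y = |X 0 ω|`. -/
noncomputable def blockBound (q ε : ℝ) (J j : ℕ) (y : ℝ) : ℝ :=
  (if J ≤ j ∧ (2 : ℝ) ^ j ≤ y ^ q then (2 : ℝ) ^ (j + 1) else 0) +
    8 / ε ^ 2 * ((if J ≤ j ∧ y ^ q < 2 ^ j then ((2 : ℝ) ^ (1 - 2 / q)) ^ j else 0) * y ^ 2)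

theorem blockBound_nonneg (q ε : ℝ) (J j : ℕ) (y : ℝ) : 0 ≤ blockBound q ε J j y := by
  unfold blockBound
  positivity

theorem measurable_blockBound (q ε : ℝ) (J j : ℕ) : Measurable (blockBound q ε J j) := by
  have h1 : MeasurableSet {y : ℝ | J ≤ j ∧ (2 : ℝ) ^ j ≤ y ^ q} :=
    (MeasurableSet.const _).inter
      (measurableSet_le measurable_const (f := fun _ : ℝ => (2 : ℝ) ^ j) (g := fun y => y ^ q)
        (by fun_prop))
  have h2 : MeasurableSet {y : ℝ | J ≤ j ∧ y ^ q < 2 ^ j} :=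
    (MeasurableSet.const _).inter
      (measurableSet_lt (f := fun y : ℝ => y ^ q) (g := fun _ => (2 : ℝ) ^ j)
        (by fun_prop) measurable_const)
  exact (Measurable.ite h1 measurable_const measurable_const).add
    (((Measurable.ite h2 measurable_const measurable_const).mul
      (measurable_id.pow_const 2)).const_mul _)

theorem sum_blockBound_le {q : ℝ} (hq : 1 ≤ q) (hq2 : q < 2) (ε : ℝ) {b : ℝ} (hb : 0 < b) {J : ℕ}
    (hbJ : b ≤ 2 ^ J) {y : ℝ} (hy : 0 ≤ y) (n : ℕ) :
    ∑ j ∈ Finset.range n, blockBound q ε J j y ≤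
      (4 + 8 / ε ^ 2 * (1 - (2 : ℝ) ^ (1 - 2 / q))⁻¹) * (if b ≤ y ^ q then y ^ q else 0) +
      8 / ε ^ 2 * (1 - (2 : ℝ) ^ (1 - 2 / q))⁻¹ *
        (((2 : ℝ) ^ (1 - 2 / q)) ^ J * b ^ (2 / q - 1)) * y ^ q := by
  have hyq : 0 ≤ y ^ q := Real.rpow_nonneg hy q
  have h1 := sum_two_pow_tail_le hyq J n
  have h2 : (if (2 : ℝ) ^ J ≤ y ^ q then 4 * y ^ q else 0) ≤
      4 * (if b ≤ y ^ q then y ^ q else 0) := by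
    split_ifs with h3 h4 h4
    · exact le_rfl
    · exact absurd (hbJ.trans h3) h4
    · positivity
    · simp
  have h3 := mul_le_mul_of_nonneg_left (sum_rpow_mul_sq_le hq hq2 hb hy J n)
    (by positivity : 0 ≤ 8 / ε ^ 2)
  simp only [blockBound]
  rw [Finset.sum_add_distrib, ← Finset.mul_sum, ← Finset.sum_mul]
  refine (add_le_add (h1.trans h2) h3).trans (le_of_eq ?_)
  ring

variable {Ω : Type*}

/-- Dyadic peeling: `j = Nat.log 2 k` gives `2 ^ j ≤ k < 2 ^ (j + 1)`. -/
theorem divLattice_subset_iUnion (X : ℕ → Ω → ℝ) {q : ℝ} (hq : 1 ≤ q) {m J : ℕ} (hm : 2 ^ J ≤ m)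
    {ε : ℝ} (hε : 0 < ε) : DivLattice X q m ε ⊆
      ⋃ j : ℕ, {ω | J ≤ j ∧ ∃ k ≤ 2 ^ (j + 1), ε * ((2 : ℝ) ^ j) ^ (1 / q) ≤ |PartialSum X k ω|} := by
  intro ω hω
  simp only [DivLattice, Set.mem_iUnion] at hω
  obtain ⟨k, hk, h⟩ := hω
  have hkJ : 2 ^ J ≤ k := hm.trans hk
  have hk0 : k ≠ 0 := ((Nat.two_pow_pos J).trans_le hkJ).ne'
  have hkpos : (0 : ℝ) < k := by exact_mod_cast Nat.pos_of_ne_zero hk0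
  refine Set.mem_iUnion.2 ⟨Nat.log 2 k, Nat.le_log_of_pow_le one_lt_two hkJ, k,
    (Nat.lt_pow_succ_log_self one_lt_two k).le, ?_⟩
  have h' : ε * (k : ℝ) ^ (1 / q) ≤ |PartialSum X k ω| :=
    (le_div_iff₀ (by positivity)).1 (show ε ≤ |PartialSum X k ω| / (k : ℝ) ^ (1 / q) from h)
  refine le_trans ?_ h'
  have h2 : ((2 : ℝ) ^ Nat.log 2 k) ≤ k := by exact_mod_cast Nat.pow_log_le_self 2 hk0
  gcongr

variable [mΩ : MeasurableSpace Ω]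

/-- The truncated maximal inequality with `N = 2 ^ (j + 1)`, `a = 2 ^ j`, `t = ε * a ^ (1 / q)`. The
drift is at most `2 * a ^ (1 / q) * u`, so `u ≤ ε / 4` keeps it below `t / 2`. -/
theorem measure_block_le {X : ℕ → Ω → ℝ} (hX : ∀ i, Measurable (X i)) {P : Measure Ω}
    (hP : P ∈ MeanZeroIID X) {q : ℝ} (hq : 1 ≤ q) {ε u : ℝ} (hε : 0 < ε) (hu : 0 ≤ u)
    (huε : u ≤ ε / 4) {b : ℝ} {J j : ℕ} (hbJ : b ≤ 2 ^ J) (hj : J ≤ j)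
    (hUI : ∫⁻ ω in {ω | b ≤ |X 0 ω| ^ q}, ENNReal.ofReal (|X 0 ω| ^ q) ∂P ≤ ENNReal.ofReal u) :
    P {ω | ∃ k ≤ 2 ^ (j + 1), ε * ((2 : ℝ) ^ j) ^ (1 / q) ≤ |PartialSum X k ω|} ≤
      ∫⁻ ω, ENNReal.ofReal (blockBound q ε J j |X 0 ω|) ∂P := by
  have hX0 := hX 0
  have hq0 : 0 < q := by linarith
  have ha : (0 : ℝ) < 2 ^ j := by positivity
  have hba : b ≤ 2 ^ j := hbJ.trans (pow_le_pow_right₀ one_le_two hj)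
  have hUIa : ∫⁻ ω in {ω | (2 : ℝ) ^ j ≤ |X 0 ω| ^ q}, ENNReal.ofReal (|X 0 ω| ^ q) ∂P ≤
      ENNReal.ofReal u :=
    (lintegral_mono_set fun ω (hω : (2 : ℝ) ^ j ≤ _) => hba.trans hω).trans hUI
  have hc := abs_integral_truncAt_le hX0 hP.2.2.2.1 hP.2.2.2.2 hq ha hu hUIa
  have hmain := measure_exists_le_abs_partialSum_le hX hP hq ha
    (t := ε * ((2 : ℝ) ^ j) ^ (1 / q)) (by positivity) (N := 2 ^ (j + 1)) (by
      push_cast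
      calc (2 : ℝ) ^ (j + 1) * |∫ ω, truncAt q (2 ^ j) (X 0 ω) ∂P|
          ≤ (2 : ℝ) ^ (j + 1) * (((2 : ℝ) ^ j) ^ (1 / q - 1) * u) := by gcongr
        _ = 2 * ((2 : ℝ) ^ j) ^ (1 / q) * u := by
            rw [Real.rpow_sub_one ha.ne', pow_succ]
            field_simp
        _ ≤ 2 * ((2 : ℝ) ^ j) ^ (1 / q) * (ε / 4) := by gcongr
        _ = ε * ((2 : ℝ) ^ j) ^ (1 / q) / 2 := by ring)
  refine hmain.trans (le_of_eq ?_)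
  have hset : MeasurableSet {ω | (2 : ℝ) ^ j ≤ |X 0 ω| ^ q} :=
    measurableSet_le measurable_const (by fun_prop)
  have hconst : 4 * ((2 ^ (j + 1) : ℕ) : ℝ) / (ε * ((2 : ℝ) ^ j) ^ (1 / q)) ^ 2 =
      8 / ε ^ 2 * ((2 : ℝ) ^ (1 - 2 / q)) ^ j := by
    have h1 : ((2 : ℝ) ^ (1 - 2 / q)) ^ j = 2 ^ j / (((2 : ℝ) ^ j) ^ (1 / q)) ^ 2 := by
      rw [← Real.rpow_natCast, ← Real.rpow_mul zero_le_two, mul_comm, Real.rpow_mul zero_le_two,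
        Real.rpow_natCast, Real.rpow_sub ha, Real.rpow_one, ← Real.rpow_natCast _ 2,
        ← Real.rpow_mul ha.le]
      congr 2
      push_cast
      ring
    rw [h1]
    push_cast
    field_simp
    ring
  have hint : ∀ ω, ENNReal.ofReal (blockBound q ε J j |X 0 ω|) =
      {ω | (2 : ℝ) ^ j ≤ |X 0 ω| ^ q}.indicator (fun _ => ((2 ^ (j + 1) : ℕ) : ℝ≥0∞)) ω +
      ENNReal.ofReal (8 / ε ^ 2 * ((2 : ℝ) ^ (1 - 2 / q)) ^ j) *
        ENNReal.ofReal (truncAt q (2 ^ j) (X 0 ω) ^ 2) := by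
    intro ω
    rw [truncAt_sq, ← ENNReal.ofReal_mul (by positivity), blockBound,
      ENNReal.ofReal_add (by positivity) (by positivity)]
    by_cases h : (2 : ℝ) ^ j ≤ |X 0 ω| ^ q
    · have h' : ω ∈ {ω | (2 : ℝ) ^ j ≤ |X 0 ω| ^ q} := h
      rw [Set.indicator_of_mem h', if_pos ⟨hj, h⟩, if_neg (fun h1 => h.not_gt h1.2),
        if_neg h.not_gt, ← ENNReal.ofReal_natCast]
      push_cast
      simp
    · have h' : ω ∉ {ω | (2 : ℝ) ^ j ≤ |X 0 ω| ^ q} := h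
      rw [Set.indicator_of_notMem h', if_neg (fun h1 => h h1.2), if_pos ⟨hj, not_le.1 h⟩,
        if_pos (not_le.1 h), mul_assoc]
      simp
  have hφ : Measurable fun ω => truncAt q (2 ^ j) (X 0 ω) := (measurable_truncAt q _).comp hX0
  rw [lintegral_congr hint, lintegral_add_left (measurable_const.indicator hset),
    lintegral_indicator_const hset, lintegral_const_mul _ (by fun_prop), hconst]

theorem lintegral_rpow_le {P : Measure Ω} [IsProbabilityMeasure P] {Y : Ω → ℝ} (hY : Measurable Y)
    {b u : ℝ} (hb : 0 ≤ b) (hu : 0 ≤ u)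
    (hUI : ∫⁻ ω in {ω | b ≤ Y ω}, ENNReal.ofReal (Y ω) ∂P ≤ ENNReal.ofReal u) :
    ∫⁻ ω, ENNReal.ofReal (Y ω) ∂P ≤ ENNReal.ofReal (b + u) := by
  have hB : MeasurableSet {ω | b ≤ Y ω} := measurableSet_le measurable_const hY
  rw [← lintegral_add_compl _ hB, add_comm, ENNReal.ofReal_add hb hu]
  refine add_le_add ?_ hUI
  calc ∫⁻ ω in {ω | b ≤ Y ω}ᶜ, ENNReal.ofReal (Y ω) ∂P
      ≤ ∫⁻ _ in {ω | b ≤ Y ω}ᶜ, ENNReal.ofReal b ∂P :=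
        setLIntegral_mono' hB.compl fun ω hω => ENNReal.ofReal_le_ofReal (not_le.1 (show ¬b ≤ Y ω from hω)).le
    _ ≤ ∫⁻ _, ENNReal.ofReal b ∂P := setLIntegral_le_lintegral _ _
    _ = ENNReal.ofReal b := by simp

/-- An explicit tail bound in the Marcinkiewicz-Zygmund strong law. -/
theorem measure_divLattice_le {X : ℕ → Ω → ℝ} (hX : ∀ i, Measurable (X i)) {P : Measure Ω}
    (hP : P ∈ MeanZeroIID X) {q : ℝ} (hq : 1 ≤ q) (hq2 : q < 2) {ε u : ℝ} (hε : 0 < ε) (hu : 0 ≤ u)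
    (huε : u ≤ ε / 4) {b : ℝ} (hb : 0 < b) {J m : ℕ} (hbJ : b ≤ 2 ^ J) (hm : 2 ^ J ≤ m)
    (hUI : ∫⁻ ω in {ω | b ≤ |X 0 ω| ^ q}, ENNReal.ofReal (|X 0 ω| ^ q) ∂P ≤ ENNReal.ofReal u) :
    P (DivLattice X q m ε) ≤
      ENNReal.ofReal ((4 + 8 / ε ^ 2 * (1 - (2 : ℝ) ^ (1 - 2 / q))⁻¹) * u +
        8 / ε ^ 2 * (1 - (2 : ℝ) ^ (1 - 2 / q))⁻¹ *
        (((2 : ℝ) ^ (1 - 2 / q)) ^ J * b ^ (2 / q - 1)) * (b + u)) := by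
  have hX0 := hX 0
  have hprob : IsProbabilityMeasure P := hP.1
  have hr := two_rpow_lt_one hq hq2
  have hinv : 0 < (1 - (2 : ℝ) ^ (1 - 2 / q))⁻¹ := inv_pos.2 (by linarith)
  set D := 8 / ε ^ 2 * (1 - (2 : ℝ) ^ (1 - 2 / q))⁻¹ with hD
  set κ := ((2 : ℝ) ^ (1 - 2 / q)) ^ J * b ^ (2 / q - 1) with hκ
  have hD0 : 0 ≤ D := by positivity
  have hκ0 : 0 ≤ κ := by positivity
  have hB : MeasurableSet {ω | b ≤ |X 0 ω| ^ q} := measurableSet_le measurable_const (by fun_prop)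
  calc P (DivLattice X q m ε)
      ≤ ∑' j : ℕ, P {ω | J ≤ j ∧
          ∃ k ≤ 2 ^ (j + 1), ε * ((2 : ℝ) ^ j) ^ (1 / q) ≤ |PartialSum X k ω|} :=
        (measure_mono (divLattice_subset_iUnion X hq hm hε)).trans (measure_iUnion_le _)
    _ ≤ ∑' j : ℕ, ∫⁻ ω, ENNReal.ofReal (blockBound q ε J j |X 0 ω|) ∂P := by
        refine ENNReal.tsum_le_tsum fun j => ?_
        by_cases hj : J ≤ j
        · simp only [hj, true_and]
          exact measure_block_le hX hP hq hε hu huε hbJ hj hUI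
        · simp [hj]
    _ = ∫⁻ ω, ∑' j : ℕ, ENNReal.ofReal (blockBound q ε J j |X 0 ω|) ∂P :=
        (lintegral_tsum fun j =>
          ((measurable_blockBound q ε J j).comp hX0.abs).ennreal_ofReal.aemeasurable).symm
    _ ≤ ∫⁻ ω, (ENNReal.ofReal (4 + D) *
          {ω | b ≤ |X 0 ω| ^ q}.indicator (fun ω => ENNReal.ofReal (|X 0 ω| ^ q)) ω +
          ENNReal.ofReal (D * κ) * ENNReal.ofReal (|X 0 ω| ^ q)) ∂P := by
        refine lintegral_mono fun ω => ENNReal.tsum_le_of_sum_range_le fun n => ?_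
        rw [← ENNReal.ofReal_sum_of_nonneg fun j _ => blockBound_nonneg q ε J j _]
        refine (ENNReal.ofReal_le_ofReal
          (sum_blockBound_le hq hq2 ε hb hbJ (abs_nonneg (X 0 ω)) n)).trans (le_of_eq ?_)
        rw [← hD, ← hκ, ENNReal.ofReal_add (by positivity) (by positivity),
          ENNReal.ofReal_mul (by positivity), ENNReal.ofReal_mul (p := D * κ) (by positivity)]
        congr 2
        by_cases h : b ≤ |X 0 ω| ^ q
        · rw [if_pos h, Set.indicator_of_mem (show ω ∈ {ω | b ≤ |X 0 ω| ^ q} from h)]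
        · rw [if_neg h, Set.indicator_of_notMem (show ω ∉ {ω | b ≤ |X 0 ω| ^ q} from h),
            ENNReal.ofReal_zero]
    _ = ENNReal.ofReal (4 + D) *
          ∫⁻ ω in {ω | b ≤ |X 0 ω| ^ q}, ENNReal.ofReal (|X 0 ω| ^ q) ∂P +
          ENNReal.ofReal (D * κ) * ∫⁻ ω, ENNReal.ofReal (|X 0 ω| ^ q) ∂P := by
        have hmeas : Measurable fun ω => ENNReal.ofReal (|X 0 ω| ^ q) := by fun_prop
        rw [lintegral_add_left ((hmeas.indicator hB).const_mul _),
          lintegral_const_mul _ (hmeas.indicator hB), lintegral_const_mul _ hmeas,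
          lintegral_indicator hB]
    _ ≤ ENNReal.ofReal (4 + D) * ENNReal.ofReal u +
          ENNReal.ofReal (D * κ) * ENNReal.ofReal (b + u) := by
        gcongr
        exact lintegral_rpow_le (by fun_prop) hb.le hu hUI
    _ = _ := by
        rw [← ENNReal.ofReal_mul (by positivity), ← ENNReal.ofReal_mul (by positivity),
          ← ENNReal.ofReal_add (by positivity) (by positivity)]

theorem uniformStrongLaw_of_unifIntegrableMoment {X : ℕ → Ω → ℝ} (hX : ∀ i, Measurable (X i))
    {q : ℝ} (hq : 1 ≤ q) (hq2 : q < 2) {Ps : Set (Measure Ω)} (hPs : Ps ⊆ MeanZeroIID X)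
    (h : UnifIntegrableMoment X q Ps) : UniformStrongLaw X q Ps := by
  intro ε' hε'
  rw [ENNReal.tendsto_nhds_zero]
  intro η hη
  obtain ⟨δ, hδ0, hδη⟩ : ∃ δ : ℝ, 0 < δ ∧ ENNReal.ofReal δ ≤ η := by
    rcases eq_or_ne η ⊤ with rfl | hη'
    · exact ⟨1, one_pos, le_top⟩
    · exact ⟨η.toReal, ENNReal.toReal_pos hη.ne' hη', ENNReal.ofReal_toReal_le⟩
  set ε := ε' / 2 with hεdef
  have hε : 0 < ε := half_pos hε'
  have hr := two_rpow_lt_one hq hq2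
  have hinv : 0 < (1 - (2 : ℝ) ^ (1 - 2 / q))⁻¹ := inv_pos.2 (by linarith)
  set D := 8 / ε ^ 2 * (1 - (2 : ℝ) ^ (1 - 2 / q))⁻¹ with hD
  have hD0 : 0 ≤ D := by positivity
  -- The order of choice matters: `u` fixes the tail term and the drift, then `b` comes from uniform
  -- integrability, and only then is `J` taken large enough to kill the remaining term.
  set u := min (ε / 4) (δ / (2 * (4 + D))) with hudef
  have hu : 0 < u := lt_min (by positivity) (by positivity)
  have hu1 : (4 + D) * u ≤ δ / 2 := by
    calc (4 + D) * u ≤ (4 + D) * (δ / (2 * (4 + D))) := by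
          gcongr
          exact min_le_right _ _
      _ = δ / 2 := by field_simp
  obtain ⟨b, hUI, hb⟩ := ((ENNReal.tendsto_nhds_zero.1 h _ (ENNReal.ofReal_pos.2 hu)).and
    (eventually_gt_atTop 0)).exists
  have hlim : Tendsto (fun J : ℕ =>
      D * (((2 : ℝ) ^ (1 - 2 / q)) ^ J * b ^ (2 / q - 1)) * (b + u)) atTop (𝓝 0) := by
    have h1 := tendsto_pow_atTop_nhds_zero_of_lt_one
      (by positivity : (0 : ℝ) ≤ 2 ^ (1 - 2 / q)) hr
    simpa using ((h1.mul_const (b ^ (2 / q - 1))).const_mul D).mul_const (b + u)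
  obtain ⟨J, hJ, hbJ⟩ := ((hlim.eventually_lt_const (half_pos hδ0)).and
    ((tendsto_pow_atTop_atTop_of_one_lt (one_lt_two (α := ℝ))).eventually_ge_atTop b)).exists
  filter_upwards [eventually_ge_atTop (2 ^ J)] with m hm
  refine iSup₂_le fun P hP => ?_
  refine (measure_mono (subset_divLattice X q m hε' (half_lt_self hε'))).trans ?_
  refine (measure_divLattice_le hX (hPs hP) hq hq2 hε hu.le (min_le_left _ _) hb hbJ hm
    ((le_iSup₂ (f := fun (P : Measure Ω) (_ : P ∈ Ps) =>
      ∫⁻ ω in {ω | b ≤ |X 0 ω| ^ q}, ENNReal.ofReal (|X 0 ω| ^ q) ∂P) P hP).trans hUI)).trans ?_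
  refine (ENNReal.ofReal_le_ofReal ?_).trans hδη
  linarith

end UniformLaw

end UniformSLLN

theorem mainTheorem10 {Ω : Type*} [MeasurableSpace Ω] (X : ℕ → Ω → ℝ)
    (hX : ∀ i, Measurable (X i)) (q : ℝ) (hq₁ : 1 ≤ q) (hq₂ : q < 2)
    (Ps : Set (Measure Ω)) (hPs : Ps ⊆ UniformSLLN.MeanZeroIID X) :
    List.TFAE
      [UniformSLLN.UnifIntegrableMoment X q Ps,
       UniformSLLN.UniformStrongLaw X q Ps,
       ∃ E : ℕ → Ω → ℝ,
         UniformSLLN.IsEProcess (UniformSLLN.GeneratedFiltration X hX) Ps E ∧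
         UniformSLLN.DivergesTailUniformly E (UniformSLLN.DivLattice X q)] := by
  tfae_have 1 → 2 := UniformSLLN.uniformStrongLaw_of_unifIntegrableMoment hX hq₁ hq₂ hPs
  tfae_have 2 → 1 := UniformSLLN.unifIntegrableMoment_of_uniformStrongLaw hX hq₁ hPs
  tfae_have 2 → 3 := UniformSLLN.exists_isEProcess_of_uniformStrongLaw hX
  tfae_have 3 → 2 := fun ⟨_, hE, hdiv⟩ => UniformSLLN.uniformStrongLaw_of_isEProcess hE hdiv
  tfae_finish
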